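/- Let $(A_i)_{i\in I}$ be a family of nonzero finitely generated abelian groups (indexed by an arbitrary set $I$, repetitions allowed), and put $M=\prod_{i\in I}A_i$ and $S=\bigoplus_{i\in I}A_i$. Let $T_S$ be the torsion subgroup of $S$ and, for each prime $p$, let $S_{(p)}$ be the $p$-component of $T_S$, i.e. the subgroup of all elements of $S$ whose order is a power of $p$. Call an abelian group $G$ self-small if for every set $\kappa$ the canonical homomorphism $$\bigoplus_{k\in\kappa}\operatorname{Hom}(G,G)\to\operatorname{Hom}\Bigl(G,\bigoplus_{k\in\kappa}G\Bigr),\qquad (f_k)_k\mapsto\sum_k f_k,$$ is an isomorphism, where on the right $f_k$ is regarded as a map into the $k$-th summand. Then the following conditions are equivalent: 1. $M$ is self-small; 2. either $T_S=0$, or $S_{(p)}$ is finite for every prime $p$ and $S/T_S$ is finitely generated; 3. either $A_i$ is a free abelian group for every $i\in I$, or for each $i\in I$ the set $\{j\in I\mid\operatorname{Hom}(A_j,A_i)\ne0\}$ is finite; 4. either $M\cong\mathbb{Z}^\kappa$ for some cardinal $\kappa$ (the full direct power), or $M\cong F\oplus\prod_{p}M_p$, the product running over all primes $p$, for some finitely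 generated free abelian group $F$ and some finite abelian $p$-groups $M_p$, one for each prime $p$. -/

import Mathlib

open scoped DirectSum

universe u v

/-- The canonical homomorphism `⨁ i, Hom(A, N i) → Hom(A, ⨁ i, N i)`, sending a finitely supported
family `(f i)` to `∑ i, f i`, where `f i` is regarded as a map into the direct sum. -/
noncomputable def homDirectSumMap (A : Type*) [AddCommGroup A] {κ : Type*} (N : κ → Type*)
    [∀ i, AddCommGroup (N i)] : (⨁ i, (A →+ N i)) →+ (A →+ ⨁ i, N i) :=
  letI := Classical.decEq κ
  DirectSum.toAddMonoid fun i => AddMonoidHom.compHom (DirectSum.of N i)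

/-- `A` is `B`-small: `Hom(A, -)` commutes with all direct sums `B^(κ)` of copies of `B`, i.e. the
canonical map `⨁_κ Hom(A, B) → Hom(A, ⨁_κ B)` is an isomorphism for every index set `κ`. -/
def IsSmallFor (A : Type u) (B : Type v) [AddCommGroup A] [AddCommGroup B] : Prop :=
  ∀ κ : Type (max u v), Function.Bijective (homDirectSumMap A fun _ : κ => B)

/-- `A` is self-small: it is `A`-small. -/
def IsSelfSmall (A : Type*) [AddCommGroup A] : Prop := IsSmallFor A A

/-!
All four conditions say that either every `A i` is free, or only finitely many `A i` have positive
rank and, for each prime `p`, only finitely many have an element of order `p`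
(`FreeOrFiniteSupports`). For the conditions on the direct sum and on the groups `Hom(A j, A i)`
this follows from the structure of finitely generated abelian groups, and the decomposition of the
product comes from rearranging the factors of the `A i`.

A homomorphism `A →+ ⨁ k, N k` comes from `⨁ k, Hom(A, N k)` exactly when only finitely many of its
components are nonzero. If the criterion fails, then for some prime `p` some `A i` has an element of
order `p` and infinitely many `A j` map onto `ZMod p`; so the product maps onto an infinite direct
sum of copies of `ZMod p`, which embeds into a direct sum of copies of the product, and the product
is not self-small (`not_isSelfSmall_of_infinite`).

Conversely, self-smallness of `F × ∏ p, P p` and of `κ → ℤ` rests on Chase's lemma (`chase`): a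
homomorphism from a product, whose index set is filtered by a height function with values in `ℕ`,
to a suitable direct sum sends a multiple of a tail of the product into finitely many summands,
since otherwise a series of elements with rapidly growing coefficients would have an image with
infinitely many nonzero components. On `∏ p, P p` the multiple is harmless, because a positive
integer acts invertibly on `P p` for almost all `p`. For `κ → ℤ`, with `κ` of arbitrary size, call
a subset of `κ` small if the functions supported in it are sent to finitely many summands. Chase's
lemma shows that the small sets form a σ-ideal and that a set which is not small contains an atom
modulo this ideal. A function on an atom is constant off a small set, because it takes only
countably many values, and the images of the functions with small support meet only finitely many
summands altogether; so atoms do not exist and `κ` itself is small. No assumption on measurable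
cardinals is needed.
-/

/-! ### Homomorphisms into direct sums and their supports -/

/-- The set of indices `k` such that the `k`-th component of `f : A →+ ⨁ k, N k` does not vanish
identically on `U`. -/
def homSupport {A : Type*} [AddCommGroup A] {κ : Type*} {N : κ → Type*} [∀ k, AddCommGroup (N k)]
    (f : A →+ ⨁ k, N k) (U : Set A) : Set κ :=
  {k | ∃ a ∈ U, f a k ≠ 0}

section homSupport

variable {A : Type*} [AddCommGroup A] {κ : Type*} {N : κ → Type*} [∀ k, AddCommGroup (N k)]

theorem homSupport_mono (f : A →+ ⨁ k, N k) {U V : Set A} (h : U ⊆ V) :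
    homSupport f U ⊆ homSupport f V :=
  fun _ ⟨a, ha, hk⟩ => ⟨a, h ha, hk⟩

theorem homSupport_subset_union (f : A →+ ⨁ k, N k) {U V W : Set A}
    (h : ∀ w ∈ W, ∃ a ∈ U, ∃ b ∈ V, w = a + b) :
    homSupport f W ⊆ homSupport f U ∪ homSupport f V := by
  rintro k ⟨w, hw, hk⟩
  obtain ⟨a, ha, b, hb, rfl⟩ := h w hw
  by_cases h0 : f a k = 0
  · refine Or.inr ⟨b, hb, fun hb0 => hk ?_⟩
    rw [map_add, DirectSum.add_apply, h0, hb0, add_zero]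
  · exact Or.inl ⟨a, ha, h0⟩

theorem DirectSum.finite_setOf_ne_zero (x : ⨁ k, N k) : {k | x k ≠ 0}.Finite :=
  DFinsupp.finite_support x

theorem homSupport_finite_of_finite (f : A →+ ⨁ k, N k) {U : Set A} (hU : U.Finite) :
    (homSupport f U).Finite := by
  refine (hU.biUnion fun a _ => DirectSum.finite_setOf_ne_zero (f a)).subset ?_
  rintro k ⟨a, ha, hk⟩
  exact Set.mem_biUnion ha hk

theorem homSupport_closure (f : A →+ ⨁ k, N k) (s : Set A) :
    homSupport f (AddSubgroup.closure s : Set A) ⊆ homSupport f s := by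
  rintro k ⟨a, ha, hk⟩
  by_contra hns
  refine hk ?_
  clear hk
  induction ha using AddSubgroup.closure_induction with
  | mem x hx => by_contra h; exact hns ⟨x, hx, h⟩
  | zero => simp
  | add x y _ _ hx hy => rw [map_add, DirectSum.add_apply, hx, hy, add_zero]
  | neg x _ hx =>
    rw [map_neg]
    exact (DFinsupp.neg_apply (f x) k).trans (by rw [hx, neg_zero])

theorem homSupport_finite_of_fg (f : A →+ ⨁ k, N k) {H : AddSubgroup A} (hH : H.FG) :
    (homSupport f (H : Set A)).Finite := by
  obtain ⟨s, rfl⟩ := hH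
  exact (homSupport_finite_of_finite f s.finite_toSet).subset (homSupport_closure f _)

theorem homDirectSumMap_apply_apply (φ : ⨁ k, (A →+ N k)) (a : A) (k : κ) :
    homDirectSumMap A N φ a k = φ k a := by
  classical
  induction φ using DirectSum.induction_on with
  | zero => simp
  | of i g =>
    have : homDirectSumMap A N (DirectSum.of (fun i => A →+ N i) i g) a = DirectSum.of N i (g a) := by
      unfold homDirectSumMap
      rw [Subsingleton.elim (Classical.decEq κ) (inferInstance : DecidableEq κ)]
      simp
    rw [this]
    by_cases h : k = i
    · subst h; simp
    · rw [DirectSum.of_eq_of_ne _ _ _ h, DirectSum.of_eq_of_ne _ _ _ h]; rfl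
  | add x y hx hy => simp [hx, hy]

/-- The canonical map `⨁ k, Hom(A, N k) → Hom(A, ⨁ k, N k)` is always injective, and its range
consists of the homomorphisms with finite support. -/
theorem homDirectSumMap_bijective_iff :
    Function.Bijective (homDirectSumMap A N) ↔
      ∀ f : A →+ ⨁ k, N k, (homSupport f Set.univ).Finite := by
  classical
  constructor
  · intro h f
    obtain ⟨φ, rfl⟩ := h.2 f
    refine (DirectSum.finite_setOf_ne_zero φ).subset ?_
    rintro k ⟨a, -, hk⟩ h0
    rw [homDirectSumMap_apply_apply, h0] at hk
    exact hk rfl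
  · refine fun h => ⟨fun φ ψ hφψ => ?_, fun f => ?_⟩
    · refine DirectSum.ext fun k => AddMonoidHom.ext fun a => ?_
      rw [← homDirectSumMap_apply_apply, hφψ, homDirectSumMap_apply_apply]
    · refine ⟨DirectSum.mk (fun k => A →+ N k) (h f).toFinset
        fun k => (DFinsupp.evalAddMonoidHom k.1).comp f, ?_⟩
      ext a k
      rw [homDirectSumMap_apply_apply]
      by_cases hk : k ∈ (h f).toFinset
      · rw [DirectSum.mk_apply_of_mem hk]; rfl
      · rw [DirectSum.mk_apply_of_notMem hk]
        by_contra h0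
        exact hk ((h f).mem_toFinset.2 ⟨a, trivial, fun h1 => h0 h1.symm⟩)

end homSupport

theorem IsSelfSmall.of_addEquiv {A B : Type u} [AddCommGroup A] [AddCommGroup B] (e : A ≃+ B)
    (h : IsSelfSmall B) : IsSelfSmall A := by
  intro κ
  rw [homDirectSumMap_bijective_iff]
  intro f
  have hB := homDirectSumMap_bijective_iff.1 (h κ)
    (((DirectSum.map fun _ : κ => e.toAddMonoidHom).comp f).comp e.symm.toAddMonoidHom)
  refine hB.subset ?_
  rintro k ⟨a, -, hk⟩
  refine ⟨e a, trivial, ?_⟩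
  simpa using hk

/-! ### Chase's lemma -/

/-- **Chase's lemma**: let `U` be a sequence of subsets of `G`, such as a complete decreasing
filtration, for which the formal series `x n + c n (x (n + 1) + c (n + 1) (x (n + 2) + ⋯))` with
`x n ∈ U n` have sums. If no `C k` has a nonzero element divisible by all positive integers, then for every homomorphism
`f : G →+ ⨁ k, C k` some multiple `d • U m` has its image in finitely many summands. -/
theorem chase {G κ : Type*} [AddCommGroup G] {C : κ → Type*} [∀ k, AddCommGroup (C k)]
    (f : G →+ ⨁ k, C k) (U : ℕ → Set G)
    (hU : ∀ (x : ℕ → G) (c : ℕ → ℕ), (∀ n, x n ∈ U n) →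
      ∃ y : ℕ → G, ∀ n, y n = x n + c n • y (n + 1))
    (hC : ∀ k (z : C k), (∀ d : ℕ, 0 < d → ∃ w, d • w = z) → z = 0) :
    ∃ d : ℕ, 0 < d ∧ ∃ m, (homSupport f ((fun x => d • x) '' U m)).Finite := by
  by_contra hcon
  push Not at hcon
  have step : ∀ (s : {s : ℕ × Set κ // 0 < s.1 ∧ s.2.Finite}) (n : ℕ),
      ∃ x ∈ U n, ∃ k, k ∉ s.1.2 ∧ f (s.1.1 • x) k ≠ 0 ∧
        ∃ c : ℕ, 0 < c ∧ ∀ w, c • w ≠ f (s.1.1 • x) k := by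
    rintro ⟨⟨d, K⟩, hd, hK⟩ n
    obtain ⟨k, ⟨_, ⟨x, hx, rfl⟩, hk⟩, hkK⟩ := (Set.Infinite.sdiff (hcon d hd n) hK).nonempty
    refine ⟨x, hx, k, hkK, hk, ?_⟩
    by_contra h
    push Not at h
    exact hk (hC k _ h)
  choose X hXU k hkK hk0 c hc hcdiv using step
  -- The state after `n` steps: the coefficient of the `n`-th term of the series and the indices
  -- met by the earlier terms.
  let next : ℕ → {s : ℕ × Set κ // 0 < s.1 ∧ s.2.Finite} →
      {s : ℕ × Set κ // 0 < s.1 ∧ s.2.Finite} := fun n s =>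
    ⟨(s.1.1 * c s n, s.1.2 ∪ {j | f (s.1.1 • X s n) j ≠ 0}),
      Nat.mul_pos s.2.1 (hc s n), s.2.2.union (DirectSum.finite_setOf_ne_zero _)⟩
  let st : ℕ → {s : ℕ × Set κ // 0 < s.1 ∧ s.2.Finite} := fun n =>
    Nat.rec ⟨(1, ∅), one_pos, Set.finite_empty⟩ next n
  have hst : ∀ n, st (n + 1) = next n (st n) := fun n => rfl
  let d : ℕ → ℕ := fun n => (st n).1.1
  let K : ℕ → Set κ := fun n => (st n).1.2
  let x : ℕ → G := fun n => X (st n) n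
  have hd : ∀ n, d (n + 1) = d n * c (st n) n := fun n => rfl
  have hK : ∀ n, K (n + 1) = K n ∪ {j | f (d n • x n) j ≠ 0} := fun n => rfl
  have hKmono : Monotone K := monotone_nat_of_le_succ fun n => by
    rw [hK]; exact Set.subset_union_left
  have hkmem : ∀ i n, i < n → k (st i) i ∈ K n := fun i n hin =>
    hKmono (Nat.succ_le_of_lt hin) (by rw [Nat.succ_eq_add_one, hK]; exact Or.inr (hk0 (st i) i))
  obtain ⟨y, hy⟩ := hU x (fun n => c (st n) n) fun n => hXU _ _
  have hsum : ∀ n, ∃ z : G, y 0 = z + d n • y n ∧ ∀ j ∉ K n, f z j = 0 := by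
    intro n
    induction n with
    | zero => exact ⟨0, by simp [d, st], by simp⟩
    | succ n ih =>
      obtain ⟨z, hz, hzK⟩ := ih
      refine ⟨z + d n • x n, ?_, fun j hj => ?_⟩
      · rw [hz, hd, hy n, smul_add, mul_smul, add_assoc]
      · rw [hK] at hj
        simp only [Set.mem_union, Set.mem_ofPred_eq, not_or, not_not] at hj
        rw [map_add, DirectSum.add_apply, hzK j hj.1, hj.2, add_zero]
  -- In the component `k (st n) n` the terms before the `n`-th vanish, and those after it are divisible
  -- by an integer which does not divide the `n`-th term.
  have hne : ∀ n, f (y 0) (k (st n) n) ≠ 0 := by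
    intro n h0
    obtain ⟨z, hz, hzK⟩ := hsum n
    have hz' : y 0 = z + (d n • x n + c (st n) n • (d n • y (n + 1))) := by
      rw [hz, hy n, smul_add, smul_comm]
    rw [hz', map_add, DirectSum.add_apply, hzK _ (hkK _ _), zero_add, map_add,
      DirectSum.add_apply] at h0
    refine hcdiv (st n) n (-(f (d n • y (n + 1)) (k (st n) n))) ?_
    rw [map_nsmul f (c (st n) n)] at h0
    have h1 : (c (st n) n • f (d n • y (n + 1))) (k (st n) n) =
      c (st n) n • (f (d n • y (n + 1)) (k (st n) n)) := DFinsupp.smul_apply _ _ _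
    rw [h1] at h0
    rw [smul_neg]
    exact (eq_neg_of_add_eq_zero_left h0).symm
  have hinj : Function.Injective fun n => k (st n) n := by
    have hlt : ∀ i n, i < n → k (st i) i ≠ k (st n) n := fun i n hin h =>
      hkK (st n) n (h ▸ hkmem i n hin)
    intro i n h
    by_contra hne
    rcases lt_or_gt_of_ne hne with hin | hin
    · exact hlt i n hin h
    · exact hlt n i hin h.symm
  exact Set.infinite_of_injective_forall_mem hinj hne
    (DirectSum.finite_setOf_ne_zero (f (y 0)))

/-- Products are complete for the filtration given by any height function `h` on the index set. -/
theorem Pi.exists_series_sum {I : Type*} {A : I → Type*} [∀ i, AddCommGroup (A i)] (h : I → ℕ)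
    (x : ℕ → ∀ i, A i) (c : ℕ → ℕ) (hx : ∀ n, ∀ i, h i < n → x n i = 0) :
    ∃ y : ℕ → ∀ i, A i, ∀ n, y n = x n + c n • y (n + 1) := by
  refine ⟨fun n i => ∑ m ∈ Finset.range (h i + 1 - n),
    (∏ l ∈ Finset.range m, c (n + l)) • x (n + m) i, fun n => funext fun i => ?_⟩
  rcases lt_or_ge (h i) n with hlt | hge
  · simp [hx n i hlt, Nat.sub_eq_zero_of_le (show h i + 1 ≤ n by omega),
      Nat.sub_eq_zero_of_le (show h i ≤ n by omega)]
  · have e : h i + 1 - n = (h i + 1 - (n + 1)) + 1 := by omega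
    simp only [Pi.add_apply, Pi.smul_apply]
    rw [e, Finset.sum_range_succ', add_comm, Finset.smul_sum]
    simp only [Finset.prod_range_succ', mul_smul, Finset.range_zero, Finset.prod_empty, one_smul,
      add_zero]
    congr 1
    refine Finset.sum_congr rfl fun m _ => ?_
    rw [smul_comm]
    simp only [add_assoc, add_comm 1]

/-! ### Self-smallness of powers of the integers -/

section IntPower

variable {I κ : Type*} {C : κ → Type*} [∀ k, AddCommGroup (C k)]

/-- The indices `k` met by the restriction of `f` to the functions supported in `X`. -/
def coordSupport (f : (I → ℤ) →+ ⨁ k, C k) (X : Set I) : Set κ :=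
  homSupport f {x | ∀ i ∉ X, x i = 0}

theorem coordSupport_mono (f : (I → ℤ) →+ ⨁ k, C k) {X Y : Set I} (h : X ⊆ Y) :
    coordSupport f X ⊆ coordSupport f Y :=
  homSupport_mono f fun _ hx i hi => hx i fun hX => hi (h hX)

theorem coordSupport_union (f : (I → ℤ) →+ ⨁ k, C k) (X Y : Set I) :
    coordSupport f (X ∪ Y) ⊆ coordSupport f X ∪ coordSupport f Y := by
  refine homSupport_subset_union f fun w hw => ⟨X.indicator w, fun i hi => ?_, Xᶜ.indicator w,
    fun i hi => ?_, (Set.indicator_self_add_compl X w).symm⟩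
  · exact Set.indicator_of_notMem hi w
  · by_cases hX : i ∈ X
    · exact Set.indicator_of_notMem (not_not.2 hX) w
    · rw [Set.indicator_of_mem (show i ∈ Xᶜ from hX)]
      exact hw i fun h => h.elim hX hi

variable (hC : ∀ k (z : C k), (∀ d : ℕ, 0 < d → ∃ w, d • w = z) → z = 0)
  (htf : ∀ k (z : C k) (d : ℕ), 0 < d → d • z = 0 → z = 0)

include hC htf in
/-- Chase's lemma for powers of `ℤ`; the multiplier disappears since the target is torsion-free. -/
theorem exists_finite_coordSupport_tail (f : (I → ℤ) →+ ⨁ k, C k) (h : I → ℕ) :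
    ∃ m, (coordSupport f {i | m ≤ h i}).Finite := by
  obtain ⟨d, hd, m, hfin⟩ := chase f (fun n => {x | ∀ i, h i < n → x i = 0})
    (fun x c hx => Pi.exists_series_sum h x c hx) hC
  refine ⟨m, hfin.subset ?_⟩
  rintro k ⟨x, hx, hk⟩
  refine ⟨d • x, ⟨x, fun i hi => hx i (by simpa using hi), rfl⟩, fun h0 => hk ?_⟩
  refine htf k _ d hd ?_
  rw [map_nsmul] at h0
  exact (DFinsupp.smul_apply d (f x) k).symm.trans h0

include hC htf in
/-- The sets with finite support are closed under countable unions. -/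
theorem finite_coordSupport_iUnion (f : (I → ℤ) →+ ⨁ k, C k) (Y : ℕ → Set I)
    (hY : ∀ n, (coordSupport f (Y n)).Finite) : (coordSupport f (⋃ n, Y n)).Finite := by
  classical
  let h : I → ℕ := fun i => if hi : ∃ n, i ∈ Y n then Nat.find hi else 0
  obtain ⟨m, hm⟩ := exists_finite_coordSupport_tail hC htf f h
  have hfin : ∀ m, (coordSupport f (⋃ n < m, Y n)).Finite := by
    intro m
    induction m with
    | zero =>
      refine (homSupport_finite_of_finite f (Set.finite_singleton 0)).subset
        (homSupport_mono f fun x hx => ?_)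
      exact funext fun i => hx i (by simp)
    | succ m ih =>
      rw [Set.biUnion_lt_succ]
      exact (ih.union (hY m)).subset (coordSupport_union f _ _)
  refine ((hm.union (hfin m)).subset (coordSupport_union f _ _)).subset (coordSupport_mono f ?_)
  intro i hi
  rw [Set.mem_iUnion] at hi
  by_cases him : m ≤ h i
  · exact Or.inl him
  · refine Or.inr (Set.mem_biUnion (x := h i) (not_le.1 him) ?_)
    simp only [h, dif_pos hi]
    exact Nat.find_spec hi

include hC htf in
/-- A set with infinite support contains an atom: otherwise it could be split again and again, and
the sets split off would contradict `exists_finite_coordSupport_tail`. -/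
theorem exists_atom_coordSupport (f : (I → ℤ) →+ ⨁ k, C k)
    (hf : (coordSupport f Set.univ).Infinite) :
    ∃ X, (coordSupport f X).Infinite ∧
      ∀ Y ⊆ X, (coordSupport f Y).Finite ∨ (coordSupport f (X \ Y)).Finite := by
  classical
  by_contra hcon
  have hsplit : ∀ X : {X // (coordSupport f X).Infinite}, ∃ Y ⊆ X.1,
      (coordSupport f Y).Infinite ∧ (coordSupport f (X.1 \ Y)).Infinite := by
    rintro ⟨X, hX⟩
    by_contra h
    refine hcon ⟨X, hX, fun Y hY => ?_⟩
    by_contra h'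
    rw [not_or] at h'
    exact h ⟨Y, hY, h'⟩
  choose S hSsub hSinf hSdiff using hsplit
  let X : ℕ → {X // (coordSupport f X).Infinite} := fun n =>
    Nat.rec ⟨Set.univ, hf⟩ (fun _ Z => ⟨S Z, hSinf Z⟩) n
  have hX : ∀ n, (X (n + 1)).1 = S (X n) := fun n => rfl
  have hanti : Antitone fun n => (X n).1 := antitone_nat_of_succ_le fun n => by
    rw [hX]; exact hSsub _
  let h : I → ℕ := fun i => if hi : ∃ n, i ∉ (X n).1 then Nat.find hi else 0
  obtain ⟨m, hm⟩ := exists_finite_coordSupport_tail hC htf f h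
  refine hSdiff (X m) (hm.subset (coordSupport_mono f ?_))
  rintro i ⟨hi, hi'⟩
  have hex : ∃ n, i ∉ (X n).1 := ⟨m + 1, hi'⟩
  simp only [h, Set.mem_ofPred_eq, dif_pos hex]
  by_contra hlt
  exact Nat.find_spec hex (hanti (not_le.1 hlt).le hi)

include hC htf in
/-- On an atom every function is constant off a set with finite support, and the supports of all
these sets have a finite union, so that an atom would have finite support itself. -/
theorem finite_homSupport_int_pi (f : (I → ℤ) →+ ⨁ k, C k) : (homSupport f Set.univ).Finite := by
  classical
  -- A countable union of sets witnessing infinitely many indices would have finite support.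
  have hU : (⋃ Y ∈ {Y : Set I | (coordSupport f Y).Finite}, coordSupport f Y).Finite := by
    by_contra hinf
    have hinf' : Set.Infinite _ := hinf
    let k := hinf'.natEmbedding
    have hk : ∀ n, ∃ Y, (coordSupport f Y).Finite ∧ (k n : κ) ∈ coordSupport f Y := by
      intro n
      obtain ⟨Y, hY, hkY⟩ := Set.mem_iUnion₂.1 (k n).2
      exact ⟨Y, hY, hkY⟩
    choose Y hYfin hkY using hk
    refine Set.infinite_of_injective_forall_mem
      (Subtype.val_injective.comp k.injective) (fun n => ?_)
      (finite_coordSupport_iUnion hC htf f Y hYfin)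
    exact coordSupport_mono f (Set.subset_iUnion Y n) (hkY n)
  by_contra hf
  obtain ⟨X, hX, hatom⟩ := exists_atom_coordSupport hC htf f (by simpa [coordSupport] using hf)
  refine hX ((hU.union (homSupport_finite_of_finite f
    (Set.finite_singleton (X.indicator fun _ => (1 : ℤ))))).subset ?_)
  rintro k ⟨x, hx, hk⟩
  -- `x` takes countably many values, so one of its fibres in `X` has infinite support.
  obtain ⟨v, hv⟩ : ∃ v : ℤ, ¬ (coordSupport f {i ∈ X | x i = v}).Finite := by
    by_contra hall
    push Not at hall
    obtain ⟨e, he⟩ := exists_surjective_nat ℤ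
    refine hX ((finite_coordSupport_iUnion hC htf f (fun n => {i ∈ X | x i = e n})
      fun n => hall _).subset (coordSupport_mono f fun i hi => ?_))
    obtain ⟨n, hn⟩ := he (x i)
    exact Set.mem_iUnion.2 ⟨n, hi, hn.symm⟩
  have hfin := (hatom {i ∈ X | x i = v} (Set.sep_subset _ _)).resolve_left hv
  set o : I → ℤ := X.indicator fun _ => (1 : ℤ) with ho
  have hx' : x = (x - v • o) + v • o := by abel
  by_cases h0 : f (x - v • o) k = 0
  · refine Or.inr ⟨_, rfl, fun h1 => hk ?_⟩
    rw [hx', map_add, DirectSum.add_apply, h0, map_zsmul]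
    have : (v • f o) k = v • (f o k) := DFinsupp.smul_apply _ _ _
    rw [this, h1, smul_zero, add_zero]
  · refine Or.inl (Set.mem_biUnion hfin ⟨_, fun i hi => ?_, h0⟩)
    by_cases hiX : i ∈ X
    · have : x i = v := by
        by_contra hne
        exact hi ⟨hiX, fun h => hne h.2⟩
      simp [ho, hiX, this]
    · simp [ho, hiX, hx i hiX]

end IntPower

theorem Int.eq_zero_of_forall_exists_nsmul_eq (z : ℤ) (h : ∀ d : ℕ, 0 < d → ∃ w, d • w = z) :
    z = 0 := by
  by_contra hz
  obtain ⟨w, hw⟩ := h (2 * z.natAbs) (by positivity)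
  have h1 : 2 * z.natAbs ∣ z.natAbs := by
    refine Int.natCast_dvd.1 ⟨w, ?_⟩
    rw [← nsmul_eq_mul, hw]
  have := Nat.le_of_dvd (by omega) h1
  omega

theorem isSelfSmall_int_pi (I : Type u) : IsSelfSmall (I → ℤ) := by
  intro κ
  rw [homDirectSumMap_bijective_iff]
  refine fun f => finite_homSupport_int_pi (fun _ z hz => funext fun i => ?_)
    (fun _ z d hd hz => funext fun i => ?_) f
  · refine Int.eq_zero_of_forall_exists_nsmul_eq _ fun d hd => ?_
    obtain ⟨w, hw⟩ := hz d hd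
    exact ⟨w i, congrFun hw i⟩
  · have := congrFun hz i
    simpa [hd.ne'] using this

/-! ### Self-smallness of products of finite primary groups -/

/-- Multiplication by a number coprime to all the orders is onto on a product of finite
`p`-groups, so that Chase's lemma applies to a whole tail of the product. -/
theorem finite_homSupport_pi_primary {P : Nat.Primes → Type*} [∀ p, AddCommGroup (P p)]
    (hP : ∀ p, Finite (P p) ∧ IsPGroup (p : ℕ) (Multiplicative (P p)))
    {κ : Type*} {C : κ → Type*} [∀ k, AddCommGroup (C k)]
    (hC : ∀ k (z : C k), (∀ d : ℕ, 0 < d → ∃ w, d • w = z) → z = 0)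
    (f : (∀ p, P p) →+ ⨁ k, C k) : (homSupport f Set.univ).Finite := by
  classical
  obtain ⟨d, hd, m, hfin⟩ := chase f (fun n => {x | ∀ p : Nat.Primes, (p : ℕ) < n → x p = 0})
    (fun x c hx => Pi.exists_series_sum (fun p : Nat.Primes => (p : ℕ)) x c hx) hC
  -- Beyond `d` the prime `p` does not divide `d`, so `P p` is divisible by `d`.
  set n := max m (d + 1)
  have hdiv : ∀ p : Nat.Primes, n ≤ p → ∀ z : P p, ∃ w, d • w = z := by
    intro p hp z
    have := (hP p).1
    have : Fact (p : ℕ).Prime := ⟨p.2⟩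
    have hcop : Nat.Coprime (Nat.card (P p)) d := by
      obtain ⟨e, he⟩ := IsPGroup.iff_card.1 (hP p).2
      rw [show Nat.card (P p) = (p : ℕ) ^ e from he]
      refine Nat.Coprime.pow_left _ ((Nat.Prime.coprime_iff_not_dvd p.2).2 fun hpd => ?_)
      have := Nat.le_of_dvd hd hpd
      have := le_max_right m (d + 1)
      omega
    exact (nsmulCoprime hcop).surjective z
  have htail : (homSupport f {x | ∀ p : Nat.Primes, (p : ℕ) < n → x p = 0}).Finite := by
    refine hfin.subset (homSupport_mono f fun x hx => ?_)
    choose w hw using fun p : {p : Nat.Primes // n ≤ p} => hdiv p.1 p.2 (x p.1)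
    refine ⟨fun p => if hp : n ≤ p then w ⟨p, hp⟩ else 0, fun p hp => ?_, funext fun p => ?_⟩
    · have := le_max_left m (d + 1)
      exact dif_neg (by omega)
    · by_cases hp : n ≤ p
      · simpa [hp] using hw ⟨p, hp⟩
      · simpa [hp] using (hx p (not_le.1 hp)).symm
  have hhead : {x : ∀ p, P p | ∀ p : Nat.Primes, n ≤ p → x p = 0}.Finite := by
    have : Finite {p : Nat.Primes // (p : ℕ) < n} :=
      Finite.of_injective (β := Fin n) (fun p => ⟨p.1, p.2⟩) fun p q h => by
        exact Subtype.ext (Subtype.ext (by simpa using h))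
    have := fun p => (hP p).1
    refine Set.Finite.of_injOn (f := fun x (p : {p : Nat.Primes // (p : ℕ) < n}) => x p.1)
      (t := Set.univ) (fun _ _ => trivial) (fun x hx y hy hxy => funext fun p => ?_)
      Set.finite_univ
    rcases lt_or_ge (p : ℕ) n with hp | hp
    · exact congrFun hxy ⟨p, hp⟩
    · rw [hx p hp, hy p hp]
  refine (htail.union (homSupport_finite_of_finite f hhead)).subset
    (homSupport_subset_union f fun x _ => ⟨fun p => if n ≤ p then x p else 0, fun p hp => ?_,
      fun p => if n ≤ p then 0 else x p, fun p hp => ?_, funext fun p => ?_⟩)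
  · exact if_neg (not_le.2 hp)
  · exact if_pos hp
  · by_cases hp : n ≤ p <;> simp [hp]

theorem isSelfSmall_free_prod_pi_primary {F : Type u} [AddCommGroup F] {P : Nat.Primes → Type u}
    [∀ p, AddCommGroup (P p)] (hF : AddGroup.FG F) (hfree : Module.Free ℤ F)
    (hP : ∀ p, Finite (P p) ∧ IsPGroup (p : ℕ) (Multiplicative (P p))) :
    IsSelfSmall (F × ∀ p, P p) := by
  intro κ
  rw [homDirectSumMap_bijective_iff]
  intro f
  have h1 : (homSupport f ((AddMonoidHom.inl F (∀ p, P p)).range : Set (F × ∀ p, P p))).Finite := by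
    refine homSupport_finite_of_fg f ?_
    rw [← AddGroup.fg_iff_addSubgroup_fg]
    exact AddGroup.fg_range _
  have h2 := finite_homSupport_pi_primary hP (fun (_ : κ) (z : F × ∀ p, P p) hz => ?_)
    (f.comp (AddMonoidHom.inr F (∀ p, P p)))
  · refine (h1.union h2).subset ?_
    rintro k ⟨x, -, hk⟩
    by_cases h0 : f (x.1, 0) k = 0
    · refine Or.inr ⟨x.2, trivial, fun h3 => hk ?_⟩
      have : x = (x.1, 0) + (0, x.2) := by simp
      rw [this, map_add, DirectSum.add_apply, h0, zero_add]
      exact h3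
    · exact Or.inl ⟨_, ⟨x.1, rfl⟩, h0⟩
  · refine Prod.ext ?_ (funext fun p => ?_)
    · refine (Module.Free.chooseBasis ℤ F).ext_elem fun i => ?_
      simp only [Prod.fst_zero, map_zero, Finsupp.coe_zero, Pi.zero_apply]
      refine Int.eq_zero_of_forall_exists_nsmul_eq _ fun d hd => ?_
      obtain ⟨w, rfl⟩ := hz d hd
      exact ⟨(Module.Free.chooseBasis ℤ F).repr w.1 i, by simp⟩
    · have := (hP p).1
      obtain ⟨w, rfl⟩ := hz (Nat.card (P p)) Nat.card_pos
      simp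

/-! ### Finitely generated abelian groups -/

section FG

variable {A : Type*} [AddCommGroup A]

theorem exists_prime_smul_eq_zero_of_dvd_addOrderOf {p : ℕ} (hp : p.Prime) {a : A}
    (ha : addOrderOf a ≠ 0) (hpa : p ∣ addOrderOf a) : ∃ x : A, x ≠ 0 ∧ p • x = 0 := by
  obtain ⟨m, hm⟩ := hpa
  have hm0 : m ≠ 0 := by rintro rfl; exact ha (by simpa using hm)
  refine ⟨m • a, fun h => ?_, ?_⟩
  · have h1 := Nat.le_of_dvd (Nat.pos_of_ne_zero hm0) (addOrderOf_dvd_of_nsmul_eq_zero h)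
    have := hp.two_le
    have : 0 < m := Nat.pos_of_ne_zero hm0
    nlinarith
  · rw [← mul_smul, ← hm, addOrderOf_nsmul_eq_zero]

theorem free_of_forall_prime_smul [hA : AddGroup.FG A]
    (h : ∀ p : ℕ, p.Prime → ∀ x : A, p • x = 0 → x = 0) : Module.Free ℤ A := by
  have : Module.Finite ℤ A := Module.Finite.iff_addGroup_fg.2 hA
  have : IsAddTorsionFree A := by
    refine ⟨fun n hn x y hxy => ?_⟩
    by_contra hne
    have h0 : n • (x - y) = 0 := by rw [smul_sub, sub_eq_zero]; exact hxy
    have hord : addOrderOf (x - y) ≠ 0 := fun h1 => by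
      have := addOrderOf_dvd_of_nsmul_eq_zero h0
      rw [h1, zero_dvd_iff] at this
      exact hn this
    obtain ⟨p, hp, hpd⟩ := Nat.exists_prime_and_dvd
      (fun h1 : addOrderOf (x - y) = 1 => hne (sub_eq_zero.1 (AddMonoid.addOrderOf_eq_one_iff.1 h1)))
    obtain ⟨z, hz, hpz⟩ := exists_prime_smul_eq_zero_of_dvd_addOrderOf hp hord hpd
    exact hz (h p hp z hpz)
  infer_instance

theorem eq_zero_of_free_of_smul [Module.Free ℤ A] {n : ℕ} (hn : n ≠ 0) {x : A} (h : n • x = 0) :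
    x = 0 := by
  refine (Module.Free.chooseBasis ℤ A).ext_elem fun i => ?_
  have := congrArg (fun y => (Module.Free.chooseBasis ℤ A).repr y i) h
  simpa [hn] using this

/-- A finitely generated abelian group without nonzero homomorphisms to `ℤ` is a torsion group. -/
theorem exists_smul_eq_zero_of_not_nontrivial_hom_int [hA : AddGroup.FG A]
    (h : ¬ Nontrivial (A →+ ℤ)) (a : A) : ∃ n : ℕ, n ≠ 0 ∧ n • a = 0 := by
  have : Module.Finite ℤ A := Module.Finite.iff_addGroup_fg.2 hA
  have hs := not_nontrivial_iff_subsingleton.1 h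
  have h0 : (Submodule.Quotient.mk a : A ⧸ Submodule.torsion ℤ A) = 0 := by
    refine (Module.Free.chooseBasis ℤ (A ⧸ Submodule.torsion ℤ A)).ext_elem fun i => ?_
    have := DFunLike.congr_fun (Subsingleton.elim
      (((Module.Free.chooseBasis ℤ (A ⧸ Submodule.torsion ℤ A)).coord i).toAddMonoidHom.comp
        (Submodule.mkQ (Submodule.torsion ℤ A)).toAddMonoidHom) 0) a
    simpa using this
  rw [Submodule.Quotient.mk_eq_zero, Submodule.mem_torsion_iff] at h0
  obtain ⟨⟨n, hn⟩, hna⟩ := h0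
  have hn0 : n ≠ 0 := nonZeroDivisors.ne_zero hn
  refine ⟨n.natAbs, by simpa using hn0, ?_⟩
  have hna' : n • a = 0 := hna
  rcases Int.natAbs_eq n with h1 | h1 <;> rw [h1] at hna' <;> simpa using hna'

theorem finite_setOf_smul_eq_zero [hA : AddGroup.FG A] :
    {a : A | ∃ n : ℕ, n ≠ 0 ∧ n • a = 0}.Finite := by
  have : Module.Finite ℤ A := Module.Finite.iff_addGroup_fg.2 hA
  have : Finite (Submodule.torsion ℤ A) :=
    Module.finite_of_fg_torsion _ (Submodule.torsion_isTorsion)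
  refine (Set.toFinite (Submodule.torsion ℤ A : Set A)).subset ?_
  rintro a ⟨n, hn, hna⟩
  refine (Submodule.mem_torsion_iff _).2 ⟨⟨n, by simpa using hn⟩, ?_⟩
  change (n : ℤ) • a = 0
  simpa using hna

theorem eq_zero_of_forall_hom_zmod (p : ℕ) [Fact p.Prime] [Module (ZMod p) A] (v : A)
    (h : ∀ φ : A →+ ZMod p, φ v = 0) : v = 0 :=
  (Module.forall_dual_apply_eq_zero_iff (ZMod p) v).1 fun φ => h φ.toAddMonoidHom

/-- By Nakayama's lemma, a finitely generated abelian group `A` without nonzero homomorphisms to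
`ZMod p`, that is with `A = p A`, is annihilated by an integer congruent to `1` modulo `p`. -/
theorem exists_annihilator_of_not_nontrivial_hom_zmod [hA : AddGroup.FG A] (p : ℕ) [Fact p.Prime]
    (h : ¬ Nontrivial (A →+ ZMod p)) : ∃ r : ℤ, (p : ℤ) ∣ r - 1 ∧ ∀ a : A, r • a = 0 := by
  have hfin : Module.Finite ℤ A := Module.Finite.iff_addGroup_fg.2 hA
  have hs := not_nontrivial_iff_subsingleton.1 h
  let N : Submodule ℤ A := Ideal.span {(p : ℤ)} • ⊤
  have hmem : ∀ a : A, p • a ∈ N := fun a => by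
    have := Submodule.smul_mem_smul (Ideal.mem_span_singleton_self (p : ℤ))
      (Submodule.mem_top (x := a))
    simpa using this
  let _ : Module (ZMod p) (A ⧸ N) := AddCommGroup.zmodModule fun x => by
    obtain ⟨a, rfl⟩ := Submodule.Quotient.mk_surjective N x
    rw [← Submodule.Quotient.mk_smul, Submodule.Quotient.mk_eq_zero]
    exact hmem a
  have hN : (⊤ : Submodule ℤ A) ≤ N := by
    intro a _
    rw [← Submodule.Quotient.mk_eq_zero]
    refine eq_zero_of_forall_hom_zmod p _ fun φ => ?_
    exact DFunLike.congr_fun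
      (Subsingleton.elim (φ.comp (Submodule.mkQ N).toAddMonoidHom) 0) a
  obtain ⟨r, hr, hra⟩ := Submodule.exists_sub_one_mem_and_smul_eq_zero_of_fg_of_le_smul
    (Ideal.span {(p : ℤ)}) ⊤ hfin.fg_top hN
  exact ⟨r, Ideal.mem_span_singleton.1 hr, fun a => hra a trivial⟩

theorem nontrivial_hom_zmod_of_smul_eq_zero [AddGroup.FG A] {p : ℕ} [Fact p.Prime]
    (h : ∃ x : A, x ≠ 0 ∧ p • x = 0) : Nontrivial (A →+ ZMod p) := by
  obtain ⟨x, hx, hpx⟩ := h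
  by_contra hn
  obtain ⟨r, ⟨c, hc⟩, hra⟩ := exists_annihilator_of_not_nontrivial_hom_zmod p hn
  have h1 := hra x
  have h2 : r = c * p + 1 := by linarith
  rw [h2, add_smul, mul_smul, natCast_zsmul, hpx, smul_zero, zero_add, one_smul] at h1
  exact hx h1

theorem nontrivial_hom_zmod_of_nontrivial_hom_int [AddGroup.FG A] (p : ℕ) [hp : Fact p.Prime]
    (h : Nontrivial (A →+ ℤ)) : Nontrivial (A →+ ZMod p) := by
  by_contra hn
  obtain ⟨r, hr, hra⟩ := exists_annihilator_of_not_nontrivial_hom_zmod p hn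
  obtain ⟨φ, hφ⟩ := exists_ne (0 : A →+ ℤ)
  refine hφ (AddMonoidHom.ext fun a => ?_)
  have h1 : r * φ a = 0 := by
    have := congrArg φ (hra a)
    simpa using this
  refine (mul_eq_zero.1 h1).resolve_left ?_
  rintro rfl
  have h2 : (p : ℤ) ∣ 1 := by simpa using hr
  exact hp.out.one_lt.ne' (by exact_mod_cast Int.natAbs_dvd_natAbs.2 h2 |> Nat.dvd_one.1)

theorem nontrivial_hom_of_nontrivial_hom_zmod {B : Type*} [AddCommGroup B] {p : ℕ} [Fact p.Prime]
    (hA : Nontrivial (A →+ ZMod p)) (hB : ∃ x : B, x ≠ 0 ∧ p • x = 0) : Nontrivial (A →+ B) := by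
  obtain ⟨x, hx, hpx⟩ := hB
  obtain ⟨φ, hφ⟩ := exists_ne (0 : A →+ ZMod p)
  obtain ⟨a, ha⟩ := DFunLike.ne_iff.1 hφ
  let θ : ZMod p →+ B := ZMod.lift p ⟨zmultiplesHom _ x, by simpa using hpx⟩
  have hθ : Function.Injective θ := by
    rw [ZMod.lift_injective]
    intro m hm
    rw [ZMod.intCast_zmod_eq_zero_iff_dvd, ← addOrderOf_eq_prime hpx hx,
      addOrderOf_dvd_iff_zsmul_eq_zero]
    simpa using hm
  refine ⟨θ.comp φ, 0, fun h0 => ha ?_⟩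
  exact hθ ((DFunLike.congr_fun h0 a).trans (map_zero θ).symm)

/-- Either `B` has an element of prime order `p`, and a homomorphism `A →+ ZMod p` can be used, or `B`
is torsion-free, and a multiple of a nonzero element of `B` does not vanish. -/
theorem nontrivial_hom_of_nontrivial_hom_int [AddGroup.FG A] {B : Type*} [AddCommGroup B]
    [hfg : AddGroup.FG B] [Nontrivial B] (hA : Nontrivial (A →+ ℤ)) : Nontrivial (A →+ B) := by
  by_cases hB : ∃ p : ℕ, p.Prime ∧ ∃ x : B, x ≠ 0 ∧ p • x = 0
  · obtain ⟨p, hp, hB⟩ := hB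
    have : Fact p.Prime := ⟨hp⟩
    exact nontrivial_hom_of_nontrivial_hom_zmod (nontrivial_hom_zmod_of_nontrivial_hom_int p hA) hB
  · have hfree : Module.Free ℤ B := free_of_forall_prime_smul fun p hp x hx => by
      by_contra hx0
      exact hB ⟨p, hp, x, hx0, hx⟩
    obtain ⟨φ, hφ⟩ := exists_ne (0 : A →+ ℤ)
    obtain ⟨a, ha⟩ := DFunLike.ne_iff.1 hφ
    obtain ⟨b, hb⟩ := exists_ne (0 : B)
    refine ⟨(zmultiplesHom B b).comp φ, 0, fun h0 => hb ?_⟩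
    have h1 : φ a • b = 0 := DFunLike.congr_fun h0 a
    refine eq_zero_of_free_of_smul (n := (φ a).natAbs) (by simpa using ha) ?_
    rcases Int.natAbs_eq (φ a) with h2 | h2 <;> rw [h2] at h1 <;> simpa using h1

/-- The structure theorem, with the torsion part collected by primes. -/
theorem exists_addEquiv_int_pow_prod_primary [hA : AddGroup.FG A] :
    ∃ (n : ℕ) (P : Nat.Primes → Type) (_ : ∀ p, AddCommGroup (P p)),
      (∀ p, Finite (P p) ∧ IsPGroup (p : ℕ) (Multiplicative (P p))) ∧
      Nonempty (A ≃+ (Fin n → ℤ) × ∀ p, P p) := by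
  classical
  obtain ⟨n, J, _, q, hq, e, ⟨E⟩⟩ := AddCommGroup.equiv_free_prod_directSum_zmod A
  let s : J → Nat.Primes := fun j => ⟨q j, hq j⟩
  refine ⟨n, fun p => ∀ j : {j // s j = p}, ZMod (q j.1 ^ e j.1), fun p => inferInstance,
    fun p => ⟨?_, ?_⟩, ⟨E.trans (AddEquiv.prodCongr
      (Finsupp.linearEquivFunOnFinite ℤ ℤ (Fin n)).toAddEquiv ?_)⟩⟩
  · have : ∀ j, NeZero (q j ^ e j) := fun j => ⟨pow_ne_zero _ (hq j).ne_zero⟩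
    infer_instance
  · intro x
    refine ⟨∑ j, e j, ?_⟩
    refine Multiplicative.toAdd.injective (funext fun j => ?_)
    obtain ⟨j, rfl⟩ := j
    change (q j ^ (∑ j, e j)) • (Multiplicative.toAdd x ⟨j, rfl⟩ : ZMod (q j ^ e j)) = 0
    obtain ⟨c, hc⟩ := pow_dvd_pow (q j)
      (Finset.single_le_sum (fun i _ => Nat.zero_le (e i)) (Finset.mem_univ j))
    rw [hc, mul_comm, mul_smul, nsmul_eq_mul (q j ^ e j), ZMod.natCast_self, zero_mul, smul_zero]
  · refine (DirectSum.addEquivProd fun j => ZMod (q j ^ e j)).trans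
      { toFun := fun x p j => x j.1
        invFun := fun y j => y (s j) ⟨j, rfl⟩
        left_inv := fun x => rfl
        right_inv := fun y => ?_
        map_add' := fun x y => rfl }
    funext p j
    obtain ⟨j, rfl⟩ := j
    rfl

end FG

/-! ### Families of finitely generated abelian groups -/

/-- The indices of the groups of positive rank, that is with a nonzero homomorphism to `ℤ`. -/
def rankSupport {ι : Type*} (A : ι → Type*) [∀ i, AddCommGroup (A i)] : Set ι :=
  {j | Nontrivial (A j →+ ℤ)}

/-- The indices of the groups having an element of order `p`. -/
def primeSupport {ι : Type*} (A : ι → Type*) [∀ i, AddCommGroup (A i)] (p : ℕ) : Set ι :=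
  {j | ∃ x : A j, x ≠ 0 ∧ p • x = 0}

/-- The criterion through which the four conditions are compared: all the groups are free, or only
finitely many of them have positive rank and, for each prime `p`, only finitely many have an element
of order `p`. -/
def FreeOrFiniteSupports {ι : Type*} (A : ι → Type*) [∀ i, AddCommGroup (A i)] : Prop :=
  (∀ i, Module.Free ℤ (A i)) ∨
    (rankSupport A).Finite ∧ ∀ p : ℕ, p.Prime → (primeSupport A p).Finite

section Family

variable {ι : Type u} {A : ι → Type v} [∀ i, AddCommGroup (A i)]

/-- The product maps onto a direct sum of infinitely many copies of `ZMod p`, each of which is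
embedded into a copy of the product. -/
theorem not_isSelfSmall_of_infinite {p : ℕ} [hp : Fact p.Prime]
    (hinf : {j | Nontrivial (A j →+ ZMod p)}.Infinite) (hp' : (primeSupport A p).Nonempty) :
    ¬ IsSelfSmall (∀ i, A i) := by
  classical
  intro hself
  obtain ⟨i₀, x₀, hx₀, hpx₀⟩ := hp'
  let e := hinf.natEmbedding
  have hunit : ∀ n, ∃ (φ : A (e n) →+ ZMod p) (a : A (e n)), φ a = 1 := by
    intro n
    have : Nontrivial (A (e n) →+ ZMod p) := (e n).2
    obtain ⟨φ, hφ⟩ := exists_ne (0 : A (e n) →+ ZMod p)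
    obtain ⟨b, hb⟩ := DFunLike.ne_iff.1 hφ
    refine ⟨φ, (φ b)⁻¹.val • b, ?_⟩
    rw [map_nsmul, nsmul_eq_mul, ZMod.natCast_val, ZMod.cast_id', id, inv_mul_cancel₀ hb]
  choose φ a ha using hunit
  let m₀ : ∀ i, A i := Pi.single i₀ x₀
  have hm₀ : m₀ ≠ 0 := by simpa [m₀] using hx₀
  have hpm₀ : p • m₀ = 0 := by
    rw [← Pi.single_smul, hpx₀, Pi.single_zero]
  let θ : ZMod p →+ ∀ i, A i := ZMod.lift p ⟨zmultiplesHom _ m₀, by simpa using hpm₀⟩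
  have hθ : θ 1 = m₀ := by
    have := ZMod.lift_coe p ⟨zmultiplesHom (∀ i, A i) m₀, by simpa using hpm₀⟩ 1
    simpa using this
  let κ := ULift.{max u v} ℕ
  let Θ : (ℕ →₀ ZMod p) →+ ⨁ _ : κ, ∀ i, A i :=
    Finsupp.liftAddHom fun n => (DirectSum.of (fun _ : κ => ∀ i, A i) ⟨n⟩).comp θ
  -- A linear retraction of the product of the copies of `ZMod p` onto their direct sum.
  obtain ⟨L, hL⟩ := (Finsupp.lcoeFun : (ℕ →₀ ZMod p) →ₗ[ZMod p] _).exists_leftInverse_of_injective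
    (LinearMap.ker_eq_bot.2 DFunLike.coe_injective)
  let ψ : (∀ i, A i) →+ ℕ → ZMod p :=
    { toFun := fun x n => φ n (x (e n))
      map_zero' := by ext; simp
      map_add' := fun x y => by ext; simp }
  have hψ : ∀ n, ψ (Pi.single (e n : ι) (a n)) = Finsupp.lcoeFun (R := ZMod p)
      (Finsupp.single n (1 : ZMod p)) := by
    intro n
    funext l
    rcases eq_or_ne l n with rfl | hln
    · simp [ψ, ha, Finsupp.lcoeFun]
    · have : (e l : ι) ≠ e n := fun h => hln (e.injective (Subtype.ext h))
      simp [ψ, Finsupp.lcoeFun, this, hln]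
  have hfin := homDirectSumMap_bijective_iff.1 (hself κ) ((Θ.comp L.toAddMonoidHom).comp ψ)
  refine Set.infinite_univ (hfin.subset fun k _ => ?_)
  obtain ⟨n⟩ := k
  refine ⟨Pi.single (e n : ι) (a n), trivial, ?_⟩
  have h1 : L (ψ (Pi.single (e n : ι) (a n))) = Finsupp.single n 1 := by
    rw [hψ]; exact LinearMap.congr_fun hL _
  have h2 : ((Θ.comp L.toAddMonoidHom).comp ψ) (Pi.single (e n : ι) (a n)) =
      DirectSum.of (fun _ : κ => ∀ i, A i) ⟨n⟩ m₀ := by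
    change Θ (L (ψ _)) = _
    rw [h1]
    simp [Θ, hθ]
  rw [h2, DirectSum.of_eq_same]
  exact hm₀

variable (hfg : ∀ i, AddGroup.FG (A i))

include hfg in
theorem exists_prime_primeSupport_nonempty (h : ¬ ∀ i, Module.Free ℤ (A i)) :
    ∃ p : ℕ, p.Prime ∧ (primeSupport A p).Nonempty := by
  by_contra hcon
  push Not at hcon
  refine h fun i => free_of_forall_prime_smul fun p hp x hx => ?_
  by_contra hx0
  exact Set.eq_empty_iff_forall_notMem.1 (hcon p hp) i ⟨x, hx0, hx⟩

include hfg in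
theorem IsSelfSmall.freeOrFiniteSupports (h : IsSelfSmall (∀ i, A i)) :
    FreeOrFiniteSupports A := by
  by_cases hfree : ∀ i, Module.Free ℤ (A i)
  · exact Or.inl hfree
  refine Or.inr ⟨?_, fun p hp => ?_⟩
  · obtain ⟨p, hp, hne⟩ := exists_prime_primeSupport_nonempty hfg hfree
    have : Fact p.Prime := ⟨hp⟩
    by_contra hinf
    refine not_isSelfSmall_of_infinite (Set.Infinite.mono (fun j hj => ?_) hinf) hne h
    exact nontrivial_hom_zmod_of_nontrivial_hom_int p hj
  · have : Fact p.Prime := ⟨hp⟩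
    by_contra hinf
    refine not_isSelfSmall_of_infinite (Set.Infinite.mono (fun j hj => ?_) hinf)
      (Set.Infinite.nonempty hinf) h
    exact nontrivial_hom_zmod_of_smul_eq_zero hj

include hfg in
theorem free_or_finite_hom_of_freeOrFiniteSupports (h : FreeOrFiniteSupports A) :
    (∀ i, Module.Free ℤ (A i)) ∨ ∀ i, {j | Nontrivial (A j →+ A i)}.Finite := by
  refine h.imp_right fun ⟨hR, hT⟩ i => ?_
  have hprimes : {p : ℕ | p.Prime ∧ i ∈ primeSupport A p}.Finite := by
    refine Set.Finite.subset ((finite_setOf_smul_eq_zero (A := A i)).image addOrderOf) ?_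
    rintro p ⟨hp, x, hx, hpx⟩
    have : Fact p.Prime := ⟨hp⟩
    exact ⟨x, ⟨p, hp.ne_zero, hpx⟩, addOrderOf_eq_prime hpx hx⟩
  refine (hR.union (hprimes.biUnion fun p hp => hT p hp.1)).subset fun j hj => ?_
  by_cases hjR : j ∈ rankSupport A
  · exact Or.inl hjR
  have : Nontrivial (A j →+ A i) := hj
  obtain ⟨φ, hφ⟩ := exists_ne (0 : A j →+ A i)
  obtain ⟨a, ha⟩ := DFunLike.ne_iff.1 hφ
  obtain ⟨n, hn, hna⟩ := exists_smul_eq_zero_of_not_nontrivial_hom_int hjR a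
  have ha0 : addOrderOf a ≠ 0 := fun h0 => hn <| by
    simpa [h0] using addOrderOf_dvd_of_nsmul_eq_zero hna
  have hdvd : addOrderOf (φ a) ∣ addOrderOf a := addOrderOf_map_dvd φ a
  obtain ⟨p, hp, hpd⟩ := Nat.exists_prime_and_dvd
    (fun h1 : addOrderOf (φ a) = 1 => ha (AddMonoid.addOrderOf_eq_one_iff.1 h1))
  exact Or.inr (Set.mem_biUnion (x := p) ⟨hp, exists_prime_smul_eq_zero_of_dvd_addOrderOf hp
    (ne_zero_of_dvd_ne_zero ha0 hdvd) hpd⟩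
    (exists_prime_smul_eq_zero_of_dvd_addOrderOf hp ha0 (hpd.trans hdvd)))

include hfg in
theorem freeOrFiniteSupports_of_free_or_finite_hom (hne : ∀ i, Nontrivial (A i))
    (h : (∀ i, Module.Free ℤ (A i)) ∨ ∀ i, {j | Nontrivial (A j →+ A i)}.Finite) :
    FreeOrFiniteSupports A := by
  refine h.imp_right fun h => ⟨?_, fun p hp => ?_⟩
  · rcases (rankSupport A).eq_empty_or_nonempty with h0 | ⟨i, -⟩
    · rw [h0]; exact Set.finite_empty
    exact (h i).subset fun j hj => nontrivial_hom_of_nontrivial_hom_int hj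
  · rcases (primeSupport A p).eq_empty_or_nonempty with h0 | ⟨i, hi⟩
    · rw [h0]; exact Set.finite_empty
    have : Fact p.Prime := ⟨hp⟩
    exact (h i).subset fun j hj =>
      nontrivial_hom_of_nontrivial_hom_zmod (nontrivial_hom_zmod_of_smul_eq_zero hj) hi

end Family

/-! ### The direct sum -/

section Family

variable {ι : Type u} {A : ι → Type v} [∀ i, AddCommGroup (A i)]

theorem mem_torsion_iff_exists_nsmul {G : Type*} [AddCommGroup G] {x : G} :
    x ∈ AddCommGroup.torsion G ↔ ∃ n : ℕ, n ≠ 0 ∧ n • x = 0 := by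
  change IsOfFinAddOrder x ↔ _
  rw [isOfFinAddOrder_iff_nsmul_eq_zero]
  simp only [Nat.pos_iff_ne_zero]

theorem eq_zero_of_notMem_primeSupport {p : ℕ} {i : ι} (hi : i ∉ primeSupport A p) {k : ℕ}
    {x : A i} (h : p ^ k • x = 0) : x = 0 := by
  induction k with
  | zero => simpa using h
  | succ k ih =>
    refine ih ?_
    by_contra h0
    exact hi ⟨_, h0, by rwa [← mul_smul, ← pow_succ']⟩

variable (hfg : ∀ i, AddGroup.FG (A i))

include hfg in
theorem finite_primaryComponent_directSum {p : ℕ} (hp : p.Prime) (hT : (primeSupport A p).Finite) :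
    Finite (AddCommGroup.primaryComponent (⨁ i, A i) p) := by
  have hmem : ∀ (g : AddCommGroup.primaryComponent (⨁ i, A i) p), ∃ k : ℕ,
      ∀ i, p ^ k • (g : ⨁ i, A i) i = 0 := by
    intro g
    obtain ⟨k, hk⟩ := AddCommGroup.mem_primaryComponent.1 g.2
    refine ⟨k, fun i => ?_⟩
    have := DFunLike.congr_fun hk i
    exact (DFinsupp.smul_apply _ _ _).symm.trans this
  have : Finite (primeSupport A p) := hT
  have : ∀ i, Finite {a : A i | ∃ n : ℕ, n ≠ 0 ∧ n • a = 0} := fun i => finite_setOf_smul_eq_zero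
  refine Finite.of_injective
    (β := ∀ i : primeSupport A p, {a : A i | ∃ n : ℕ, n ≠ 0 ∧ n • a = 0})
    (fun g i => ⟨(g : ⨁ i, A i) i, ?_⟩) fun g g' h => ?_
  · obtain ⟨k, hk⟩ := hmem g
    exact ⟨p ^ k, pow_ne_zero _ hp.ne_zero, hk i⟩
  · refine Subtype.ext (DirectSum.ext fun i => ?_)
    by_cases hi : i ∈ primeSupport A p
    · exact congrArg Subtype.val (congrFun h ⟨i, hi⟩)
    · obtain ⟨k, hk⟩ := hmem g
      obtain ⟨k', hk'⟩ := hmem g'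
      rw [eq_zero_of_notMem_primeSupport hi (hk i), eq_zero_of_notMem_primeSupport hi (hk' i)]

include hfg in
/-- The groups of rank zero are torsion, so the others generate the quotient. -/
theorem fg_directSum_quotient_torsion (hR : (rankSupport A).Finite) :
    AddGroup.FG ((⨁ i, A i) ⧸ AddCommGroup.torsion (⨁ i, A i)) := by
  classical
  have : Fintype (rankSupport A) := hR.fintype
  have : ∀ i, Module.Finite ℤ (A i) := fun i => Module.Finite.iff_addGroup_fg.2 (hfg i)
  have : AddGroup.FG (∀ i : rankSupport A, A i) :=
    Module.Finite.iff_addGroup_fg.1 inferInstance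
  let Ψ : (∀ i : rankSupport A, A i) →+ (⨁ i, A i) ⧸ AddCommGroup.torsion (⨁ i, A i) :=
    (QuotientAddGroup.mk' _).comp
      (∑ i : rankSupport A, (DirectSum.of A i).comp (Pi.evalAddMonoidHom _ i))
  refine AddGroup.fg_of_surjective (f := Ψ) fun q => ?_
  obtain ⟨s, rfl⟩ := QuotientAddGroup.mk'_surjective _ q
  change _ ∈ Ψ.range
  induction s using DirectSum.induction_on with
  | zero => rw [map_zero]; exact zero_mem _
  | of i a =>
    by_cases hi : i ∈ rankSupport A
    · refine ⟨Pi.single (⟨i, hi⟩ : rankSupport A) a, ?_⟩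
      change QuotientAddGroup.mk' _ _ = _
      congr 1
      rw [AddMonoidHom.finsetSum_apply, Finset.sum_eq_single ⟨i, hi⟩]
      · simp
      · intro j _ hj
        simp [hj]
      · simp
    · obtain ⟨n, hn, hna⟩ := exists_smul_eq_zero_of_not_nontrivial_hom_int hi a
      have h0 : QuotientAddGroup.mk' (AddCommGroup.torsion (⨁ i, A i)) (DirectSum.of A i a) = 0 :=
        (QuotientAddGroup.eq_zero_iff _).2
          (mem_torsion_iff_exists_nsmul.2 ⟨n, hn, by rw [← map_nsmul, hna, map_zero]⟩)
      rw [h0]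
      exact zero_mem _
  | add x y hx hy => rw [map_add]; exact add_mem hx hy

include hfg in
theorem torsion_directSum_of_freeOrFiniteSupports (h : FreeOrFiniteSupports A) :
    AddCommGroup.torsion (⨁ i, A i) = ⊥ ∨
      ((∀ (p : ℕ) [Fact p.Prime], Finite (AddCommGroup.primaryComponent (⨁ i, A i) p)) ∧
        AddGroup.FG ((⨁ i, A i) ⧸ AddCommGroup.torsion (⨁ i, A i))) := by
  refine h.imp (fun hfree => ?_) fun ⟨hR, hT⟩ => ⟨fun p hp =>
    finite_primaryComponent_directSum hfg hp.out (hT p hp.out), fg_directSum_quotient_torsion hfg hR⟩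
  refine (AddSubgroup.eq_bot_iff_forall _).2 fun x hx => DirectSum.ext fun i => ?_
  obtain ⟨n, hn, hnx⟩ := mem_torsion_iff_exists_nsmul.1 hx
  have := hfree i
  exact eq_zero_of_free_of_smul hn
    ((DFinsupp.smul_apply n x i).symm.trans (DFunLike.congr_fun hnx i))

include hfg in
theorem freeOrFiniteSupports_of_torsion_directSum
    (h : AddCommGroup.torsion (⨁ i, A i) = ⊥ ∨
      ((∀ (p : ℕ) [Fact p.Prime], Finite (AddCommGroup.primaryComponent (⨁ i, A i) p)) ∧
        AddGroup.FG ((⨁ i, A i) ⧸ AddCommGroup.torsion (⨁ i, A i)))) :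
    FreeOrFiniteSupports A := by
  classical
  refine h.imp (fun h i => free_of_forall_prime_smul fun p hp x hx => ?_) fun ⟨hp, hq⟩ =>
    ⟨?_, fun p hpp => ?_⟩
  · refine DirectSum.of_injective (β := A) i ?_
    rw [map_zero, ← AddSubgroup.mem_bot, ← h, mem_torsion_iff_exists_nsmul]
    exact ⟨p, hp.ne_zero, by rw [← map_nsmul, hx, map_zero]⟩
  · have hφ : ∀ i, ∃ φ : A i →+ ℤ, i ∈ rankSupport A → φ ≠ 0 := by
      intro i
      by_cases hi : i ∈ rankSupport A
      · have : Nontrivial (A i →+ ℤ) := hi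
        obtain ⟨φ, hφ⟩ := exists_ne (0 : A i →+ ℤ)
        exact ⟨φ, fun _ => hφ⟩
      · exact ⟨0, fun h => absurd h hi⟩
    choose φ hφ using hφ
    let Φ : (⨁ i, A i) ⧸ AddCommGroup.torsion (⨁ i, A i) →+ ⨁ _ : ι, ℤ :=
      QuotientAddGroup.lift _ (DirectSum.map φ) fun x hx => DirectSum.ext fun i => by
        obtain ⟨n, hn, hnx⟩ := mem_torsion_iff_exists_nsmul.1 hx
        have h1 := congrArg (fun y => DirectSum.map φ y i) hnx
        have h2 : (n • DirectSum.map φ x) i = n • DirectSum.map φ x i := DFinsupp.smul_apply _ _ _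
        simp only [map_nsmul, map_zero, h2] at h1
        simpa [hn] using h1
    refine (homSupport_finite_of_fg Φ hq.out).subset fun i hi => ?_
    obtain ⟨a, ha⟩ := DFunLike.ne_iff.1 (hφ i hi)
    refine ⟨QuotientAddGroup.mk (DirectSum.of A i a), trivial, ?_⟩
    change DirectSum.map φ (DirectSum.of A i a) i ≠ 0
    simpa using ha
  · have : Fact p.Prime := ⟨hpp⟩
    have := hp p
    choose x hx hpx using fun i : primeSupport A p => i.2
    refine Set.finite_coe_iff.1 (Finite.of_injective (β := AddCommGroup.primaryComponent (⨁ i, A i) p)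
      (fun i => ⟨DirectSum.of A i (x i), AddCommGroup.mem_primaryComponent.2 ⟨1, by
        rw [pow_one, ← map_nsmul, hpx, map_zero]⟩⟩) fun i j hij => ?_)
    by_contra hne
    refine hx i ?_
    have h1 := DFunLike.congr_fun (congrArg Subtype.val hij) (i : ι)
    rwa [DirectSum.of_eq_same, DirectSum.of_eq_of_ne _ _ _ fun h => hne (Subtype.ext h)] at h1

/-! ### The product -/

theorem finite_pi_of_subsingleton {β : ι → Type*} {s : Set ι} (hs : s.Finite)
    (h : ∀ i ∉ s, Subsingleton (β i)) [∀ i, Finite (β i)] : Finite (∀ i, β i) := by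
  have : Finite s := hs
  refine Finite.of_injective (β := ∀ i : s, β i) (fun x i => x i) fun x y hxy => funext fun i => ?_
  by_cases hi : i ∈ s
  · exact congrFun hxy ⟨i, hi⟩
  · exact (h i hi).elim _ _

theorem isPGroup_pi_of_subsingleton {β : ι → Type*} [∀ i, AddCommGroup (β i)] {s : Set ι}
    (hs : s.Finite) (h : ∀ i ∉ s, Subsingleton (β i)) {p : ℕ}
    (hβ : ∀ i, IsPGroup p (Multiplicative (β i))) : IsPGroup p (Multiplicative (∀ i, β i)) := by
  intro x
  choose k hk using fun i => hβ i (Multiplicative.ofAdd (Multiplicative.toAdd x i))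
  refine ⟨∑ i ∈ hs.toFinset, k i, Multiplicative.toAdd.injective (funext fun i => ?_)⟩
  by_cases hi : i ∈ s
  · obtain ⟨c, hc⟩ := pow_dvd_pow p
      (Finset.single_le_sum (fun i _ => Nat.zero_le (k i)) (hs.mem_toFinset.2 hi))
    have hk' : p ^ k i • Multiplicative.toAdd x i = 0 := hk i
    change p ^ (∑ i ∈ hs.toFinset, k i) • Multiplicative.toAdd x i = 0
    rw [hc, mul_comm, mul_smul, hk', smul_zero]
  · exact (h i hi).elim _ _

include hfg in
theorem exists_addEquiv_of_freeOrFiniteSupports (h : FreeOrFiniteSupports A) :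
    (∃ κ : Type (max u v), Nonempty ((∀ i, A i) ≃+ (κ → ℤ))) ∨
      ∃ (F : Type (max u v)) (_ : AddCommGroup F) (P : Nat.Primes → Type (max u v))
        (_ : ∀ p, AddCommGroup (P p)),
        AddGroup.FG F ∧ Module.Free ℤ F ∧
        (∀ p, Finite (P p) ∧ IsPGroup (p : ℕ) (Multiplicative (P p))) ∧
        Nonempty ((∀ i, A i) ≃+ F × (∀ p, P p)) := by
  refine h.imp (fun hfree => ?_) fun ⟨hR, hT⟩ => ?_
  · have : ∀ i, Module.Finite ℤ (A i) := fun i => Module.Finite.iff_addGroup_fg.2 (hfg i)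
    have := hfree
    refine ⟨Σ i, Module.Free.ChooseBasisIndex ℤ (A i), ⟨(AddEquiv.piCongrRight fun i =>
      (Module.Free.chooseBasis ℤ (A i)).equivFun.toAddEquiv).trans
        { toFun := fun x s => x s.1 s.2
          invFun := fun y i j => y ⟨i, j⟩
          left_inv := fun _ => rfl
          right_inv := fun _ => rfl
          map_add' := fun _ _ => rfl }⟩⟩
  · choose n P instP hP e using fun i => exists_addEquiv_int_pow_prod_primary (A := A i)
    have hn : ∀ i ∉ rankSupport A, n i = 0 := by
      intro i hi
      by_contra h0
      refine hi ⟨((Pi.evalAddMonoidHom _ ⟨0, Nat.pos_of_ne_zero h0⟩).comp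
        (AddMonoidHom.fst _ _)).comp (e i).some.toAddMonoidHom, 0, fun h => ?_⟩
      have := DFunLike.congr_fun h ((e i).some.symm (fun _ => 1, 0))
      simp at this
    have hPsub : ∀ (p : Nat.Primes), ∀ i ∉ primeSupport A p, Subsingleton (P i p) := by
      intro p i hi
      refine ⟨fun x y => ?_⟩
      classical
      obtain ⟨k, hk⟩ := (hP i p).2 (Multiplicative.ofAdd (x - y))
      have hk' : (p : ℕ) ^ k • (x - y) = 0 := hk
      have h0 := eq_zero_of_notMem_primeSupport hi (k := k)
        (x := (e i).some.symm (0, Pi.single p (x - y))) (by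
          rw [← map_nsmul, Prod.smul_mk, smul_zero, ← Pi.single_smul, hk', Pi.single_zero]
          exact map_zero _)
      rw [map_eq_zero_iff _ (e i).some.symm.injective, Prod.mk_eq_zero, Pi.single_eq_zero_iff] at h0
      exact sub_eq_zero.1 h0.2
    have : Finite (rankSupport A) := hR
    have : Finite (Σ i, Fin (n i)) :=
      Finite.of_injective (β := Σ i : rankSupport A, Fin (n i))
        (fun s => ⟨⟨s.1, by
          by_contra h0
          exact (Fin.cast (hn _ h0) s.2).elim0⟩, s.2⟩) (by
        rintro ⟨i, a⟩ ⟨j, b⟩ h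
        simp only [Sigma.mk.injEq, Subtype.mk.injEq] at h
        obtain ⟨rfl, h⟩ := h
        rw [eq_of_heq h])
    have hPfin : ∀ p, Finite (∀ i, P i p) := fun p => by
      have := fun i => (hP i p).1
      exact finite_pi_of_subsingleton (hT p p.2) (hPsub p)
    let F := (Σ i, Fin (n i)) → ℤ
    let E : (∀ i, A i) ≃+ F × ∀ (p : Nat.Primes) i, P i p :=
      (AddEquiv.piCongrRight fun i => (e i).some).trans
        { toFun := fun x => (fun s => (x s.1).1 s.2, fun p i => (x i).2 p)
          invFun := fun y i => (fun j => y.1 ⟨i, j⟩, fun p => y.2 p i)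
          left_inv := fun _ => rfl
          right_inv := fun _ => rfl
          map_add' := fun _ _ => rfl }
    refine ⟨ULift.{max u v} F, inferInstance, fun p => ULift.{max u v} (∀ i, P i p), inferInstance,
      ?_, ?_, fun p => ⟨?_, ?_⟩, ⟨E.trans (AddEquiv.prodCongr AddEquiv.ulift.symm
        (AddEquiv.piCongrRight fun p => AddEquiv.ulift.symm))⟩⟩
    · exact Module.Finite.iff_addGroup_fg.1 inferInstance
    · infer_instance
    · have := hPfin p
      infer_instance
    · exact (isPGroup_pi_of_subsingleton (hT p p.2) (hPsub p) fun i => (hP i p).2).of_equiv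
        (AddEquiv.toMultiplicative AddEquiv.ulift.symm)

end Family

theorem mainTheorem1 {ι : Type u} (A : ι → Type v) [∀ i, AddCommGroup (A i)]
    (hne : ∀ i, Nontrivial (A i)) (hfg : ∀ i, AddGroup.FG (A i)) :
    List.TFAE [
      IsSelfSmall (∀ i, A i),
      AddCommGroup.torsion (⨁ i, A i) = ⊥ ∨
        ((∀ (p : ℕ) [Fact p.Prime], Finite (AddCommGroup.primaryComponent (⨁ i, A i) p)) ∧
          AddGroup.FG ((⨁ i, A i) ⧸ AddCommGroup.torsion (⨁ i, A i))),
      (∀ i, Module.Free ℤ (A i)) ∨ ∀ i, {j | Nontrivial (A j →+ A i)}.Finite,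
      (∃ κ : Type (max u v), Nonempty ((∀ i, A i) ≃+ (κ → ℤ))) ∨
        ∃ (F : Type (max u v)) (_ : AddCommGroup F) (P : Nat.Primes → Type (max u v))
          (_ : ∀ p, AddCommGroup (P p)),
          AddGroup.FG F ∧ Module.Free ℤ F ∧
          (∀ p, Finite (P p) ∧ IsPGroup (p : ℕ) (Multiplicative (P p))) ∧
          Nonempty ((∀ i, A i) ≃+ F × (∀ p, P p))] := by
  tfae_have 1 → 2 := fun h => torsion_directSum_of_freeOrFiniteSupports hfg
    (h.freeOrFiniteSupports hfg)
  tfae_have 2 → 3 := fun h => free_or_finite_hom_of_freeOrFiniteSupports hfg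
    (freeOrFiniteSupports_of_torsion_directSum hfg h)
  tfae_have 3 → 4 := fun h => exists_addEquiv_of_freeOrFiniteSupports hfg
    (freeOrFiniteSupports_of_free_or_finite_hom hfg hne h)
  tfae_have 4 → 1
  | .inl ⟨κ, ⟨e⟩⟩ => (isSelfSmall_int_pi κ).of_addEquiv e
  | .inr ⟨F, _, P, _, hF, hfree, hP, ⟨e⟩⟩ =>
    (isSelfSmall_free_prod_pi_primary hF hfree hP).of_addEquiv e
  tfae_finish
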